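/- Let $k\ge 2$ and $\mathcal A_k=\{1,\dots,k\}$. For a one-sided or two-sided sequence $x$ over $\mathcal A_k$ (that is, $x\in\mathcal A_k^{\mathbb N}$ or $x\in\mathcal A_k^{\mathbb Z}$) let $F_x(n)$ be the set of its factors (contiguous subwords) of length $n$, and let $F_x=\bigcup_{n\ge 0}F_x(n)$. A factor $u$ of $x$ is right-special (left-special) if there are letters $a\neq b$ with $ua,ub\in F_x$ (respectively $au,bu\in F_x$), and bispecial if it is both. The sequence $x$ is called Arnoux–Rauzy if every factor of $x$ occurs in $x$ with bounded gaps, $|F_x(n)|=(k-1)n+1$ for every $n$, and for every $n$ the set $F_x(n)$ contains exactly one right-special and exactly one left-special factor. Its Arnoux–Rauzy subshift is the set $X$ of all sequences $y$, one-sided or two-sided as $x$ is, such that $F_y(n)=F_x(n)$ for every $n$; write $F_X=F_x$. Let $\varepsilon=w_1,w_2,w_3,\dots$ be the bispecial factors ordered so that $0=|w_1|<|w_2|<|w_3|<\cdots$. The index sequence $(i_n)_{n\ge 1}$ of $X$ is defined by letting $i_n$ be the unique letter for which $i_nw_n$ is right-special. The subshift $X$ is called linearly recurrent if there is an integer $K>0$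 such that every $w\in F_X$ is contained as a contiguous subword in every $v\in F_X$ of length $K|w|$. **Theorem.** Let $X$ be a one-sided or two-sided Arnoux–Rauzy subshift over $\mathcal A_k$. Then its index sequence $(i_n)_{n\ge 1}$ is well defined (it exists and is unique), and $X$ is linearly recurrent if and only if every letter $a\in\mathcal A_k$ occurs in $(i_n)$ with bounded gaps, that is, for every $a$ there is $g\in\mathbb N$ such that for every $m\ge 1$ at least one of $i_m,\dots,i_{m+g-1}$ equals $a$. -/

import Mathlib

namespace ArnouxRauzy

/-- The word `x_j x_{j+1} … x_{j+n-1}` of a one-sided (`ι = ℕ`) or two-sided (`ι = ℤ`)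
sequence `x`. -/
def window {ι A : Type*} [AddMonoidWithOne ι] (x : ι → A) (j : ι) (n : ℕ) : List A :=
  List.ofFn fun t : Fin n => x (j + ((t : ℕ) : ι))

/-- The set `F_x` of all factors (finite subwords, the empty word included) of `x`. -/
def factors {ι A : Type*} [AddMonoidWithOne ι] (x : ι → A) : Set (List A) :=
  {u | ∃ (j : ι) (n : ℕ), u = window x j n}

/-- The set `F_x(n)` of all factors of length `n`. -/
def factorsOfLength {ι A : Type*} [AddMonoidWithOne ι] (x : ι → A) (n : ℕ) : Set (List A) :=
  {u | u ∈ factors x ∧ u.length = n}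

/-- `u` is a right-special element of the set of words `L`: it lies in `L` and it has at least
two extensions to the right by one letter in `L`. -/
def IsRightSpecial {A : Type*} (L : Set (List A)) (u : List A) : Prop :=
  u ∈ L ∧ ∃ a b : A, a ≠ b ∧ u ++ [a] ∈ L ∧ u ++ [b] ∈ L

/-- `u` is a left-special element of the set of words `L`. -/
def IsLeftSpecial {A : Type*} (L : Set (List A)) (u : List A) : Prop :=
  u ∈ L ∧ ∃ a b : A, a ≠ b ∧ a :: u ∈ L ∧ b :: u ∈ L

/-- `u` is bispecial in `L`: both right-special and left-special. -/
def IsBispecial {A : Type*} (L : Set (List A)) (u : List A) : Prop :=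
  IsRightSpecial L u ∧ IsLeftSpecial L u

/-- Every factor of `x` occurs in `x` with bounded gaps: for some `g`, among any `g` consecutive
positions there is one at which the factor occurs. -/
def IsUniformlyRecurrent {ι A : Type*} [AddMonoidWithOne ι] (x : ι → A) : Prop :=
  ∀ u ∈ factors x, ∃ g : ℕ, ∀ j : ι, ∃ t < g, window x (j + (t : ι)) u.length = u

/-- Arnoux-Rauzy sequences over the alphabet `Fin k`. -/
structure IsARSequence {ι : Type*} [AddMonoidWithOne ι] {k : ℕ} (x : ι → Fin k) : Prop where
  uniformlyRecurrent : IsUniformlyRecurrent x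
  complexity : ∀ n : ℕ, (factorsOfLength x n).ncard = (k - 1) * n + 1
  rightSpecial : ∀ n : ℕ, ∃! u : List (Fin k), u.length = n ∧ IsRightSpecial (factors x) u
  leftSpecial : ∀ n : ℕ, ∃! u : List (Fin k), u.length = n ∧ IsLeftSpecial (factors x) u

/-- The subshift associated with `x`: all sequences that have the same factors as `x`. -/
def subshiftOf {ι A : Type*} [AddMonoidWithOne ι] (x : ι → A) : Set (ι → A) :=
  {y | ∀ n : ℕ, factorsOfLength y n = factorsOfLength x n}

/-- `X` is an Arnoux-Rauzy subshift over `Fin k`, one-sided if `ι = ℕ`, two-sided if `ι = ℤ`. -/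
def IsARSubshift {ι : Type*} [AddMonoidWithOne ι] {k : ℕ} (X : Set (ι → Fin k)) : Prop :=
  ∃ x : ι → Fin k, IsARSequence x ∧ X = subshiftOf x

/-- The set `F_X` of all factors of elements of `X`. -/
def language {ι A : Type*} [AddMonoidWithOne ι] (X : Set (ι → A)) : Set (List A) :=
  {u | ∃ y ∈ X, u ∈ factors y}

/-- `i` is the index sequence of `X`: if `w 0, w 1, w 2, …` are the bispecial factors of `X` in
the order of increasing length, then `i n` is the letter for which `i n :: w n` is
right-special. -/
def IsIndexSequence {ι A : Type*} [AddMonoidWithOne ι] (X : Set (ι → A)) (i : ℕ → A) : Prop :=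
  ∃ w : ℕ → List A, StrictMono (fun n => (w n).length) ∧
    Set.range w = {u | IsBispecial (language X) u} ∧
    ∀ n : ℕ, IsRightSpecial (language X) (i n :: w n)

/-- `X` is `K`-linearly recurrent for some positive integer `K`: every `w ∈ F_X` is a contiguous
subword of every `v ∈ F_X` of length `K |w|`. -/
def IsLinearlyRecurrent {ι A : Type*} [AddMonoidWithOne ι] (X : Set (ι → A)) : Prop :=
  ∃ K : ℕ, 0 < K ∧ ∀ w ∈ language X, ∀ v ∈ language X, v.length = K * w.length → w <:+: v

/-- The letter `a` occurs in the sequence `i` with bounded gaps: for some `g`, among any `g`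
consecutive terms of `i` at least one equals `a`. -/
def OccursWithBoundedGaps {A : Type*} (a : A) (i : ℕ → A) : Prop :=
  ∃ g : ℕ, ∀ m : ℕ, ∃ t < g, i (m + t) = a

end ArnouxRauzy

/-!
Everything depends only on the language `L` of factors of an Arnoux–Rauzy sequence, and a two-sided
such sequence has the same factors as its restriction to `ℕ`
(`factors_comp_intCast`), so it suffices to treat one-sided sequences `x`.

By the complexity hypothesis, special words have all `k` extensions. By uniqueness, the right-special
words are suffixes, and the left-special words prefixes, of one another; in particular a bispecial
word `w n` is both a prefix and a suffix of every later one. Two counting arguments give the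
quantitative input: a right-special word `u` occurs in every factor of length `k * u.length`
(`IsARSequence.infix_of_rightSpecial`), and `w (n + 1)` is at most about `k + 1` times as long as
`w n` (`IsARSequence.exists_bispecial`). The second one also shows that there are infinitely many
bispecial words, whence the existence of the index sequence `i`.

The link between `i` and occurrences is that `a :: w m` occurs in `w (m + g)` exactly if `a` is one
of `i m, …, i (m + g - 1)` (`IsBispecialEnum.cons_infix`,
`IsBispecialEnum.exists_index_eq_of_cons_infix`).

If all letters occur in `i` within any `g` consecutive terms, then `w (n + g)` contains every
`a :: w n`, hence every complete first return to `w n`, hence every factor of length at most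
`(w n).length` (`IsARSequence.infix_of_forall_cons_infix`). As `w (n + g)` has length comparable to
that of `w n` and occurs in every factor `k` times as long, `L` is linearly recurrent.

If conversely `L` is linearly recurrent, then `w (n + 1)` cannot have a period that is small compared
with its length, so the lengths grow geometrically (`IsBispecialEnum.length_succ_lt_mul`). After a
bounded number `g` of steps `w (m + g)` is so long that it contains all the words `a :: w m`, so all
letters occur among `i m, …, i (m + g - 1)`.
-/

namespace ArnouxRauzy

/-! ### Windows and factors of a one-sided sequence -/

section Window

variable {A : Type*} (x : ℕ → A)

@[simp] theorem length_window {ι : Type*} [AddMonoidWithOne ι] (x : ι → A) (j : ι) (n : ℕ) :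
    (window x j n).length = n := by
  simp [window]

@[simp] theorem window_zero (j : ℕ) : window x j 0 = [] := by
  simp [window]

theorem window_succ (j n : ℕ) : window x j (n + 1) = x j :: window x (j + 1) n := by
  simp [window, List.ofFn_succ, add_comm, add_left_comm]

theorem window_add (j m n : ℕ) :
    window x j (m + n) = window x j m ++ window x (j + m) n := by
  induction m generalizing j with
  | zero => simp
  | succ m ih =>
    rw [Nat.succ_add_eq_add_succ, Nat.add_succ, window_succ, ih, window_succ, List.cons_append]
    congr 3
    omega

theorem window_succ' (j n : ℕ) : window x j (n + 1) = window x j n ++ [x (j + n)] := by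
  rw [window_add, window_succ, window_zero]

theorem infix_window_iff {u : List A} {j N : ℕ} :
    u <:+: window x j N ↔ ∃ s, s + u.length ≤ N ∧ window x (j + s) u.length = u := by
  constructor
  · rintro ⟨p, q, h⟩
    have hN : p.length + u.length + q.length = N := by
      simpa [add_assoc] using congrArg List.length h
    refine ⟨p.length, by omega, ?_⟩
    rw [← hN, window_add, window_add] at h
    exact ((List.append_inj (List.append_inj h (by simp)).1 (by simp)).2).symm
  · rintro ⟨s, hs, h⟩
    obtain ⟨r, rfl⟩ := Nat.exists_eq_add_of_le hs
    rw [window_add, window_add, h]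
    exact ⟨_, _, rfl⟩

theorem window_mem_factors (j n : ℕ) : window x j n ∈ factors x := ⟨j, n, rfl⟩

variable {x}

theorem mem_factors_iff {u : List A} : u ∈ factors x ↔ ∃ j, window x j u.length = u := by
  constructor
  · rintro ⟨j, n, rfl⟩
    exact ⟨j, by simp⟩
  · rintro ⟨j, h⟩
    exact ⟨j, _, h.symm⟩

theorem mem_factors_of_infix {u v : List A} (hv : v ∈ factors x) (h : u <:+: v) :
    u ∈ factors x := by
  obtain ⟨j, n, rfl⟩ := hv
  obtain ⟨s, -, hs⟩ := (infix_window_iff x).1 h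
  exact mem_factors_iff.2 ⟨_, hs⟩

theorem exists_append_mem_factors {u : List A} (hu : u ∈ factors x) (n : ℕ) :
    ∃ v : List A, v.length = n ∧ u ++ v ∈ factors x := by
  obtain ⟨j, m, rfl⟩ := hu
  exact ⟨window x (j + m) n, by simp, by rw [← window_add]; exact window_mem_factors ..⟩

theorem IsRightSpecial.of_suffix {u v : List A} (hu : IsRightSpecial (factors x) u)
    (h : v <:+ u) : IsRightSpecial (factors x) v := by
  obtain ⟨hm, a, b, hab, ha, hb⟩ := hu
  obtain ⟨p, rfl⟩ := h
  exact ⟨mem_factors_of_infix hm ⟨p, [], by simp⟩, a, b, hab,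
    mem_factors_of_infix ha ⟨p, [], by simp⟩, mem_factors_of_infix hb ⟨p, [], by simp⟩⟩

theorem IsLeftSpecial.of_prefix {u v : List A} (hu : IsLeftSpecial (factors x) u)
    (h : v <+: u) : IsLeftSpecial (factors x) v := by
  obtain ⟨hm, a, b, hab, ha, hb⟩ := hu
  obtain ⟨p, rfl⟩ := h
  exact ⟨mem_factors_of_infix hm ⟨[], p, by simp⟩, a, b, hab,
    mem_factors_of_infix ha ⟨[], p, by simp⟩, mem_factors_of_infix hb ⟨[], p, by simp⟩⟩

end Window

/-! ### Counting extensions -/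

section Counting

/-- If `T` consists of one-letter extensions `e a v` of words `v ∈ S`, only `u ∈ S` has more than
one extension in `T`, and `T` has at least `card A - 1` more elements than `S`, then every
extension of `u` is in `T`. The same count serves extensions on both sides. -/
theorem forall_extension_mem {A : Type*} [Fintype A] {S T : Set (List A)}
    (e : A → List A → List A) {u : List A} (hS : S.Finite) (hu : u ∈ S)
    (hT : ∀ v ∈ T, ∃ a, ∃ s ∈ S, v = e a s)
    (huniq : ∀ s ∈ S, s ≠ u → ∀ a b, e a s ∈ T → e b s ∈ T → a = b)
    (hcard : S.ncard + Fintype.card A ≤ T.ncard + 1) (a : A) : e a u ∈ T := by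
  classical
  by_contra ha
  let c : List A → A := fun s => if h : ∃ b, e b s ∈ T then h.choose else a
  have hc : ∀ s b, e b s ∈ T → e (c s) s ∈ T := by
    intro s b hb
    have h : ∃ b, e b s ∈ T := ⟨b, hb⟩
    simp only [c, dif_pos h]
    exact h.choose_spec
  have hsub : T ⊆ (fun s => e (c s) s) '' (S \ {u}) ∪ (fun b => e b u) '' {b | b ≠ a} := by
    intro v hv
    obtain ⟨b, s, hs, rfl⟩ := hT v hv
    by_cases hsu : s = u
    · subst hsu
      exact Or.inr ⟨b, fun h => ha (h ▸ hv), rfl⟩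
    · exact Or.inl ⟨s, ⟨hs, hsu⟩, by
        simp only [huniq s hs hsu _ _ hv (hc s b hv)]⟩
  have hfin : (S \ {u}).Finite := hS.subset Set.sdiff_subset
  have h1 := Set.ncard_le_ncard hsub ((hfin.image _).union (Set.toFinite _))
  have h2 := Set.ncard_union_le ((fun s => e (c s) s) '' (S \ {u}))
    ((fun b => e b u) '' {b | b ≠ a})
  have h3 := Set.ncard_image_le (f := fun s => e (c s) s) hfin
  have h4 := Set.ncard_image_le (f := fun b => e b u) (Set.toFinite {b | b ≠ a})
  have h5 : (S \ {u}).ncard + 1 = S.ncard := Set.ncard_sdiff_singleton_add_one hu hS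
  have h6 : ({b | b ≠ a} : Set A).ncard + 1 = Fintype.card A := by
    have := Set.ncard_sdiff_singleton_add_one (Set.mem_univ a) (Set.toFinite _)
    rw [Set.ncard_univ, Nat.card_eq_fintype_card] at this
    rw [← this]
    congr 2
    ext b
    simp
  omega

end Counting

/-! ### Special words of an Arnoux–Rauzy sequence -/

section AR

variable {k : ℕ} {x : ℕ → Fin k}

theorem finite_factorsOfLength (n : ℕ) : (factorsOfLength x n).Finite :=
  (List.finite_length_eq (Fin k) n).subset fun _ hu => hu.2

namespace IsARSequence

theorem exists_window_eq (hx : IsARSequence x) {u : List (Fin k)} (hu : u ∈ factors x) (j : ℕ) :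
    ∃ t, window x (j + t) u.length = u := by
  obtain ⟨g, hg⟩ := hx.uniformlyRecurrent u hu
  obtain ⟨t, -, ht⟩ := hg j
  exact ⟨t, by simpa using ht⟩

theorem rightSpecial_eq (hx : IsARSequence x) {u v : List (Fin k)}
    (hu : IsRightSpecial (factors x) u) (hv : IsRightSpecial (factors x) v)
    (h : u.length = v.length) : u = v :=
  (hx.rightSpecial v.length).unique ⟨h, hu⟩ ⟨rfl, hv⟩

theorem leftSpecial_eq (hx : IsARSequence x) {u v : List (Fin k)}
    (hu : IsLeftSpecial (factors x) u) (hv : IsLeftSpecial (factors x) v)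
    (h : u.length = v.length) : u = v :=
  (hx.leftSpecial v.length).unique ⟨h, hu⟩ ⟨rfl, hv⟩

theorem suffix_of_length_le (hx : IsARSequence x) {u v : List (Fin k)}
    (hu : IsRightSpecial (factors x) u) (hv : IsRightSpecial (factors x) v)
    (h : u.length ≤ v.length) : u <:+ v := by
  have hs := List.drop_suffix (v.length - u.length) v
  rwa [hx.rightSpecial_eq (hv.of_suffix hs) hu (by rw [List.length_drop]; omega)] at hs

theorem prefix_of_length_le (hx : IsARSequence x) {u v : List (Fin k)}
    (hu : IsLeftSpecial (factors x) u) (hv : IsLeftSpecial (factors x) v)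
    (h : u.length ≤ v.length) : u <+: v := by
  have hs := List.take_prefix u.length v
  rwa [hx.leftSpecial_eq (hv.of_prefix hs) hu (by rw [List.length_take]; omega)] at hs

/-- The increment of the complexity, in the form needed in `forall_extension_mem`. -/
theorem card_step (hx : IsARSequence x) (n : ℕ) :
    (factorsOfLength x n).ncard + Fintype.card (Fin k) ≤
      (factorsOfLength x (n + 1)).ncard + 1 := by
  have hk : 0 < k := Fin.pos (x 0)
  obtain ⟨k, rfl⟩ := Nat.exists_eq_add_of_lt hk
  rw [hx.complexity, hx.complexity, Fintype.card_fin]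
  simp only [zero_add, Nat.add_sub_cancel]
  linarith [Nat.mul_succ k n]

/-- A right-special word has all `k` right extensions. -/
theorem append_mem (hx : IsARSequence x) {u : List (Fin k)}
    (hu : IsRightSpecial (factors x) u) (a : Fin k) : u ++ [a] ∈ factors x := by
  refine (forall_extension_mem (S := factorsOfLength x u.length)
    (T := factorsOfLength x (u.length + 1)) (fun a v => v ++ [a]) (finite_factorsOfLength _)
    ⟨hu.1, rfl⟩ ?_ ?_ (hx.card_step _) a).1
  · rintro v ⟨hv, hl⟩
    rcases List.eq_nil_or_concat' v with rfl | ⟨s, b, rfl⟩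
    · simp at hl
    · exact ⟨b, s, ⟨mem_factors_of_infix hv ⟨[], [b], by simp⟩, by simpa using hl⟩, rfl⟩
  · rintro s ⟨hs, hl⟩ hsu a b ⟨ha, -⟩ ⟨hb, -⟩
    by_contra hab
    exact hsu (hx.rightSpecial_eq ⟨hs, a, b, hab, ha, hb⟩ hu hl)

/-- A left-special word has all `k` left extensions. -/
theorem cons_mem (hx : IsARSequence x) {u : List (Fin k)}
    (hu : IsLeftSpecial (factors x) u) (a : Fin k) : a :: u ∈ factors x := by
  refine (forall_extension_mem (S := factorsOfLength x u.length)
    (T := factorsOfLength x (u.length + 1)) (fun a v => a :: v) (finite_factorsOfLength _)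
    ⟨hu.1, rfl⟩ ?_ ?_ (hx.card_step _) a).1
  · rintro v ⟨hv, hl⟩
    cases v with
    | nil => simp at hl
    | cons b s =>
      exact ⟨b, s, ⟨mem_factors_of_infix hv ⟨[b], [], by simp⟩, by simpa using hl⟩, rfl⟩
  · rintro s ⟨hs, hl⟩ hsu a b ⟨ha, -⟩ ⟨hb, -⟩
    by_contra hab
    exact hsu (hx.leftSpecial_eq ⟨hs, a, b, hab, ha, hb⟩ hu hl)

/-! ### Occurrences of right-special words and gaps between bispecial lengths -/

/-- Linear recurrence of right-special words: two equal windows of a factor avoiding `u` would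
force the sequence, by uniqueness of right extensions, to be periodic and avoid `u` from there on;
so the windows of length `u.length` in such a factor are distinct, and the complexity bounds their
number. -/
theorem infix_of_rightSpecial (hx : IsARSequence x) {u v : List (Fin k)}
    (hu : IsRightSpecial (factors x) u) (hv : v ∈ factors x)
    (hlen : k * u.length ≤ v.length) : u <:+: v := by
  have hk : 0 < k := Fin.pos (x 0)
  obtain ⟨j, N, rfl⟩ := hv
  rw [length_window] at hlen
  by_contra hcon
  rw [infix_window_iff] at hcon
  push Not at hcon
  set n := u.length with hn
  have hnN : n ≤ N := le_trans (Nat.le_mul_of_pos_left n hk) hlen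
  have hinj : Set.InjOn (fun s => window x (j + s) n) (Finset.range (N - n + 1)) := by
    have key : ∀ s t, s < t → t + n ≤ N → window x (j + s) n ≠ window x (j + t) n := by
      intro s t hst ht heq
      have hper : ∀ m, window x (j + s + m) n = window x (j + t + m) n ∧
          window x (j + s + m) n ≠ u := by
        intro m
        induction m using Nat.strong_induction_on with
        | _ m ih =>
          constructor
          · cases m with
            | zero => exact heq
            | succ m =>
              obtain ⟨h1, h2⟩ := ih m (by omega)
              have hlet : x (j + s + m + n) = x (j + t + m + n) := by
                by_contra hne
                refine h2 (hx.rightSpecial_eq ⟨window_mem_factors .., _, _, hne, ?_, ?_⟩ hu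
                  (by simp [hn]))
                · rw [← window_succ']
                  exact window_mem_factors ..
                · rw [h1, ← window_succ']
                  exact window_mem_factors ..
              have h3 : window x (j + s + m) (n + 1) = window x (j + t + m) (n + 1) := by
                rw [window_succ', window_succ', h1, hlet]
              rw [window_succ, window_succ] at h3
              exact (List.cons.inj h3).2
          -- Beyond the end of the factor, shift back by the period `t - s`.
          · by_cases hm : s + m + n ≤ N
            · rw [add_assoc]
              exact hcon (s + m) hm
            · obtain ⟨h1, h2⟩ := ih (m - (t - s)) (by omega)
              rw [h1] at h2
              rwa [show j + t + (m - (t - s)) = j + s + m by omega] at h2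
      obtain ⟨m, hm⟩ := hx.exists_window_eq hu.1 (j + s)
      exact (hper m).2 hm
    intro s hs t ht heq
    simp only [Finset.coe_range, Set.mem_Iio] at hs ht
    rcases lt_trichotomy s t with h | h | h
    · exact absurd heq (key s t h (by omega))
    · exact h
    · exact absurd heq.symm (key t s h (by omega))
  have h1 : ((fun s => window x (j + s) n) '' (Finset.range (N - n + 1))).ncard = N - n + 1 := by
    rw [hinj.ncard_image, Set.ncard_coe_finset, Finset.card_range]
  have hsub : (fun s => window x (j + s) n) '' (Finset.range (N - n + 1)) ⊆
      factorsOfLength x n \ {u} := by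
    rintro _ ⟨s, hs, rfl⟩
    simp only [Finset.coe_range, Set.mem_Iio] at hs
    exact ⟨⟨window_mem_factors .., by simp⟩, hcon s (by omega)⟩
  have h2 := Set.ncard_le_ncard hsub ((finite_factorsOfLength n).subset Set.sdiff_subset)
  have h3 : (factorsOfLength x n \ {u}).ncard + 1 = (factorsOfLength x n).ncard :=
    Set.ncard_sdiff_singleton_add_one ⟨hu.1, rfl⟩ (finite_factorsOfLength n)
  rw [hx.complexity] at h3
  obtain ⟨k, rfl⟩ := Nat.exists_eq_add_of_lt hk
  simp only [zero_add, Nat.add_sub_cancel, Nat.succ_mul] at h3 hlen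
  omega

/-- Without a bispecial word in this range, the right-special word `u` of length `n + 1` would
have a single left extension of each length up to about `(k + 1) * (n + 1)`. As `u` occurs soon
after every factor of length `n + 2`, such a factor would be determined by its distance to `u`,
which leaves too few of them. -/
theorem exists_bispecial (hx : IsARSequence x) (hk : 2 ≤ k) (n : ℕ) :
    ∃ w, IsBispecial (factors x) w ∧ n < w.length ∧ w.length ≤ (k + 1) * (n + 1) := by
  by_contra hcon
  push Not at hcon
  obtain ⟨u, ⟨hul, hu⟩, -⟩ := hx.rightSpecial (n + 1)
  -- In the range free of bispecial words, a factor `z ++ u` is the right-special word of its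
  -- length, hence not left-special.
  have huniq : ∀ z z' : List (Fin k), z.length = z'.length → z ++ u ∈ factors x →
      z' ++ u ∈ factors x → z.length + n ≤ (k + 1) * (n + 1) → z = z' := by
    intro z
    induction z with
    | nil =>
      intro z' h _ _ _
      exact (List.eq_nil_of_length_eq_zero h.symm).symm
    | cons c z ih =>
      intro z' h hz hz' hl
      cases z' with
      | nil => simp at h
      | cons c' z' =>
        have hzm : z ++ u ∈ factors x := mem_factors_of_infix hz ⟨[c], [], by simp⟩
        have hzm' : z' ++ u ∈ factors x := mem_factors_of_infix hz' ⟨[c'], [], by simp⟩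
        rw [List.length_cons] at hl
        obtain rfl := ih z' (by simpa using h) hzm hzm' (by omega)
        congr 1
        by_contra hne
        obtain ⟨r, ⟨hrl, hr⟩, -⟩ := hx.rightSpecial (z.length + (n + 1))
        obtain ⟨p, rfl⟩ := hx.suffix_of_length_le hu hr (by omega)
        rw [List.length_append] at hrl
        obtain rfl := ih p (by omega) hzm hr.1 (by omega)
        have := hcon (z ++ u) ⟨hr, hzm, c, c', hne, hz, hz'⟩ (by rw [List.length_append]; omega)
        rw [List.length_append] at this
        omega
  -- Each factor `z` of length `n + 2` is followed by `u` after a word `p` of bounded length.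
  have hex : ∀ z ∈ factorsOfLength x (n + 2), ∃ p : List (Fin k),
      p.length < (k - 1) * (n + 1) + 1 ∧ z ++ (p ++ u) ∈ factors x := by
    rintro z ⟨hz, -⟩
    obtain ⟨y, hyl, hy⟩ := exists_append_mem_factors hz (k * (n + 1))
    obtain ⟨p, q, rfl⟩ := hx.infix_of_rightSpecial hu
      (List.suffix_append z y |>.isInfix |> mem_factors_of_infix hy) (by rw [hyl, hul])
    refine ⟨p, ?_, mem_factors_of_infix hy ⟨[], q, by simp⟩⟩
    simp only [List.length_append] at hyl
    obtain ⟨k, rfl⟩ := Nat.exists_eq_add_of_le' hk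
    simp only [add_mul, Nat.reduceSubDiff] at hyl ⊢
    omega
  choose! p hp1 hp2 using hex
  have hcard := Set.ncard_le_ncard_of_injOn (s := factorsOfLength x (n + 2))
    (t := (Finset.range ((k - 1) * (n + 1) + 1) : Set ℕ)) (fun z => (p z).length)
    (fun z hz => by simpa using hp1 z hz) (by
      intro z hz z' hz' heq
      have h1 := huniq (z ++ p z) (z' ++ p z') (by simp [hz.2, hz'.2, show _ = _ from heq])
        (by simpa using hp2 z hz) (by simpa using hp2 z' hz') (by
          have := hp1 z hz
          rw [List.length_append, hz.2]
          obtain ⟨k, rfl⟩ := Nat.exists_eq_add_of_le' hk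
          simp only [add_mul, Nat.reduceSubDiff] at this ⊢
          omega)
      exact (List.append_inj h1 (by rw [hz.2, hz'.2])).1) (Finset.finite_toSet _)
  rw [hx.complexity, Set.ncard_coe_finset, Finset.card_range] at hcard
  have : (k - 1) * (n + 2) = (k - 1) * (n + 1) + (k - 1) := by ring
  omega

/-! ### Factors of bispecial words -/

/-- Reading to the left from an occurrence of `w`, left extensions are unique until `w` is met
again. The same path can be followed inside `W`, where every `a :: w` occurs, and it does not run
out of `W` because `W` starts with `w`. -/
theorem infix_of_forall_cons_infix (hx : IsARSequence x) {w W : List (Fin k)}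
    (hw : IsLeftSpecial (factors x) w) (hW : W ∈ factors x) (hpre : w <+: W)
    (hcons : ∀ a, a :: w <:+: W) {u : List (Fin k)} (hu : u ∈ factors x)
    (hl : u.length = w.length) : u <:+: W := by
  obtain ⟨j, n, rfl⟩ := hu
  rw [length_window] at hl
  obtain ⟨d, hd⟩ := hx.exists_window_eq hw.1 j
  rw [← hl] at hd
  induction d generalizing j with
  | zero =>
    rw [add_zero] at hd
    rw [hd]
    exact hpre.isInfix
  | succ d ih =>
    have h1 := ih (j + 1) (by rw [← hd]; congr 1; omega)
    suffices h : x j :: window x (j + 1) n <:+: W by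
      rw [← window_succ, window_succ'] at h
      exact (List.prefix_append _ _).isInfix.trans h
    by_cases hjw : window x (j + 1) n = w
    · rw [hjw]
      exact hcons _
    · obtain ⟨p, q, hpq⟩ := h1
      rcases List.eq_nil_or_concat' p with rfl | ⟨p, b, rfl⟩
      -- At position `0` of `W` only `w` itself can occur.
      · refine absurd ?_ hjw
        rw [List.nil_append] at hpq
        exact (List.prefix_of_prefix_length_le ⟨q, hpq⟩ hpre (by simp [hl])).eq_of_length
          (by simp [hl])
      · have hb : b :: window x (j + 1) n <:+: W := ⟨p, q, by rw [← hpq]; simp⟩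
        obtain rfl : b = x j := by
          by_contra hne
          refine hjw (hx.leftSpecial_eq ⟨window_mem_factors .., b, x j, hne,
            mem_factors_of_infix hW hb, ?_⟩ hw (by simp [hl]))
          rw [← window_succ]
          exact window_mem_factors ..
        exact hb

/-- The bispecial word is the longest left-special prefix `l` of `v`. If `l ≠ v`, then the letter
following it in `v` determines the letter preceding it, and the right-special word `b :: l` has all
right extensions. -/
theorem exists_bispecial_of_cons_rightSpecial (hx : IsARSequence x) {a : Fin k}
    {l₀ v : List (Fin k)} (hl₀ : IsLeftSpecial (factors x) l₀) (hpre : l₀ <+: v)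
    (hv : IsRightSpecial (factors x) (a :: v)) :
    ∃ l, IsBispecial (factors x) l ∧ l₀.length ≤ l.length ∧ l.length ≤ v.length ∧
      ∀ b, IsRightSpecial (factors x) (b :: l) → b = a := by
  classical
  have hvR : IsRightSpecial (factors x) v := hv.of_suffix (List.suffix_cons a v)
  let P : ℕ → Prop := fun t => IsLeftSpecial (factors x) (v.take t)
  have hP₀ : P l₀.length := by
    change IsLeftSpecial _ _
    rwa [← List.prefix_iff_eq_take.1 hpre]
  set t := Nat.findGreatest P v.length with ht
  have hPt : IsLeftSpecial (factors x) (v.take t) := Nat.findGreatest_spec hpre.length_le hP₀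
  have hle : l₀.length ≤ t := Nat.le_findGreatest hpre.length_le hP₀
  have htv : t ≤ v.length := Nat.findGreatest_le _
  rcases htv.eq_or_lt with heq | hlt
  · rw [heq, List.take_length] at hPt
    refine ⟨v, ⟨hvR, hPt⟩, by omega, le_rfl, fun b hb => ?_⟩
    exact (List.cons.inj (hx.rightSpecial_eq hb hv (by simp))).1
  · have hnot : ¬ IsLeftSpecial (factors x) (v.take (t + 1)) :=
      Nat.findGreatest_is_greatest (Nat.lt_succ_self t) hlt
    have htl : (v.take t).length = t := by rw [List.length_take]; omega
    have hsplit : v.take (t + 1) = v.take t ++ [v[t]] := by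
      rw [List.take_succ_eq_append_getElem hlt]
    rw [hsplit] at hnot
    have hav : a :: (v.take t ++ [v[t]]) ∈ factors x := by
      rw [← hsplit]
      exact mem_factors_of_infix hv.1
        (List.prefix_cons_inj a |>.2 (List.take_prefix (t + 1) v)).isInfix
    have hmem : v.take t ++ [v[t]] ∈ factors x :=
      mem_factors_of_infix hav (List.suffix_cons _ _).isInfix
    obtain ⟨m, ⟨hml, hm⟩, -⟩ := hx.leftSpecial (t + 1)
    obtain ⟨s, rfl⟩ := hx.prefix_of_length_le hPt hm (by omega)
    obtain ⟨c, rfl⟩ : ∃ c, s = [c] := by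
      rw [← List.length_eq_one_iff]
      rw [List.length_append] at hml
      omega
    refine ⟨v.take t, ⟨⟨hPt.1, v[t], c, ?_, hmem, hm.1⟩, hPt⟩, by omega, by omega, fun b hb => ?_⟩
    · rintro h
      exact hnot (h ▸ hm)
    · by_contra hne
      exact hnot ⟨hmem, b, a, hne, hx.append_mem hb _, hav⟩

end IsARSequence

/-- A list of period `p` has at most `p` factors of length `p`. -/
theorem ncard_infix_le_of_drop_eq_take {A : Type*} {W : List A} {p : ℕ} (hp : 0 < p)
    (h : W.drop p = W.take (W.length - p)) :
    {u : List A | u <:+: W ∧ u.length = p}.ncard ≤ p := by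
  have hred : ∀ s, s + p ≤ W.length → ∃ r < p, (W.drop s).take p = (W.drop r).take p := by
    intro s
    induction s using Nat.strong_induction_on with
    | _ s ih =>
      intro hs
      by_cases hsp : s < p
      · exact ⟨s, hsp, rfl⟩
      · obtain ⟨r, rfl⟩ := Nat.exists_eq_add_of_le (not_lt.1 hsp)
        obtain ⟨q, hq, hqe⟩ := ih r (by omega) (by omega)
        refine ⟨q, hq, ?_⟩
        rw [← hqe, ← List.drop_drop, h, List.drop_take, List.take_take]
        congr 1
        omega
  have hsub : {u : List A | u <:+: W ∧ u.length = p} ⊆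
      (fun s => (W.drop s).take p) '' (Finset.range p : Set ℕ) := by
    rintro u ⟨⟨a, b, rfl⟩, rfl⟩
    obtain ⟨r, hr, he⟩ := hred a.length (by simp)
    refine ⟨r, by simpa using hr, ?_⟩
    simp only
    rw [← he]
    simp
  refine (Set.ncard_le_ncard hsub ((Finset.finite_toSet _).image _)).trans ?_
  refine (Set.ncard_image_le (Finset.finite_toSet _)).trans ?_
  rw [Set.ncard_coe_finset, Finset.card_range]

/-! ### The enumeration of bispecial words and the index sequence -/

/-- The words `w n` enumerate the bispecial words of the language `L` by increasing length. -/
def IsBispecialEnum {A : Type*} (L : Set (List A)) (w : ℕ → List A) : Prop :=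
  StrictMono (fun n => (w n).length) ∧ Set.range w = {u | IsBispecial L u}

namespace IsBispecialEnum

variable {w : ℕ → List (Fin k)}

theorem isBispecial (hw : IsBispecialEnum (factors x) w) (n : ℕ) :
    IsBispecial (factors x) (w n) := by
  have : w n ∈ Set.range w := ⟨n, rfl⟩
  rwa [hw.2] at this

theorem exists_eq (hw : IsBispecialEnum (factors x) w) {u : List (Fin k)}
    (hu : IsBispecial (factors x) u) : ∃ n, w n = u := by
  have : u ∈ Set.range w := by rwa [hw.2]
  exact this

theorem prefix_of_le (hw : IsBispecialEnum (factors x) w) (hx : IsARSequence x) {m n : ℕ}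
    (h : m ≤ n) : w m <+: w n :=
  hx.prefix_of_length_le (hw.isBispecial m).2 (hw.isBispecial n).2 (hw.1.monotone h)

theorem suffix_of_le (hw : IsBispecialEnum (factors x) w) (hx : IsARSequence x) {m n : ℕ}
    (h : m ≤ n) : w m <:+ w n :=
  hx.suffix_of_length_le (hw.isBispecial m).1 (hw.isBispecial n).1 (hw.1.monotone h)

theorem length_zero (hw : IsBispecialEnum (factors x) w) (hx : IsARSequence x) :
    (w 0).length = 0 := by
  obtain ⟨u, ⟨hul, hu⟩, -⟩ := hx.rightSpecial 0
  obtain ⟨v, ⟨hvl, hv⟩, -⟩ := hx.leftSpecial 0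
  obtain rfl := List.eq_nil_of_length_eq_zero hul
  obtain rfl := List.eq_nil_of_length_eq_zero hvl
  obtain ⟨n, hn⟩ := hw.exists_eq ⟨hu, hv⟩
  have h : (w 0).length ≤ (w n).length := hw.1.monotone (Nat.zero_le n)
  rw [hn] at h
  simpa using h

theorem length_succ_le (hw : IsBispecialEnum (factors x) w) (hx : IsARSequence x) (hk : 2 ≤ k)
    (n : ℕ) : (w (n + 1)).length ≤ (k + 1) * ((w n).length + 1) := by
  obtain ⟨u, hu, hlt, hle⟩ := hx.exists_bispecial hk (w n).length
  obtain ⟨m, rfl⟩ := hw.exists_eq hu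
  have h : n + 1 ≤ m := hw.1.lt_iff_lt.1 hlt
  exact (hw.1.monotone h).trans hle

/-- The base `k + 2` absorbs the additive constant of `length_succ_le`. -/
theorem length_add_le (hw : IsBispecialEnum (factors x) w) (hx : IsARSequence x) (hk : 2 ≤ k)
    (n g : ℕ) : (w (n + g)).length + 1 ≤ (k + 2) ^ g * ((w n).length + 1) := by
  induction g with
  | zero => simp
  | succ g ih =>
    have h := hw.length_succ_le hx hk (n + g)
    rw [add_assoc] at h
    calc (w (n + (g + 1))).length + 1 ≤ (k + 2) * ((w (n + g)).length + 1) := by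
          linarith [show (k + 2) * ((w (n + g)).length + 1) =
            (k + 1) * ((w (n + g)).length + 1) + ((w (n + g)).length + 1) by ring]
      _ ≤ (k + 2) * ((k + 2) ^ g * ((w n).length + 1)) := Nat.mul_le_mul_left _ ih
      _ = _ := by ring

end IsBispecialEnum

theorem exists_isBispecialEnum (hx : IsARSequence x) (hk : 2 ≤ k) :
    ∃ w, IsBispecialEnum (factors x) w := by
  let P : ℕ → Prop := fun n => ∃ u, IsBispecial (factors x) u ∧ u.length = n
  have hinf : {n | P n}.Infinite := by
    refine Set.infinite_of_forall_exists_gt fun n => ?_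
    obtain ⟨u, hu, h, -⟩ := hx.exists_bispecial hk n
    exact ⟨u.length, ⟨u, hu, rfl⟩, h⟩
  choose w hw hwl using fun n => Nat.nth_mem_of_infinite hinf n
  refine ⟨w, ?_, ?_⟩
  · simp only [hwl]
    exact Nat.nth_strictMono hinf
  · refine Set.Subset.antisymm (Set.range_subset_iff.2 hw) fun u hu => ?_
    have : u.length ∈ Set.range (Nat.nth P) := by
      rw [Nat.range_nth_of_infinite hinf]
      exact ⟨u, hu, rfl⟩
    obtain ⟨n, hn⟩ := this
    exact ⟨n, hx.rightSpecial_eq (hw n).1 hu.1 ((hwl n).trans hn)⟩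

theorem IsBispecialEnum.unique (hx : IsARSequence x) {w w' : ℕ → List (Fin k)}
    (hw : IsBispecialEnum (factors x) w) (hw' : IsBispecialEnum (factors x) w') : w = w' := by
  have hl : (fun n => (w n).length) = fun n => (w' n).length := by
    refine (hw.1.range_inj hw'.1).1 ?_
    rw [← Function.comp_def, ← Function.comp_def List.length w', Set.range_comp, Set.range_comp,
      hw.2, hw'.2]
  funext n
  exact hx.rightSpecial_eq (hw.isBispecial n).1 (hw'.isBispecial n).1 (congrFun hl n)

theorem IsARSequence.exists_cons_rightSpecial (hx : IsARSequence x) {u : List (Fin k)}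
    (hu : IsRightSpecial (factors x) u) : ∃ a, IsRightSpecial (factors x) (a :: u) := by
  obtain ⟨v, ⟨hvl, hv⟩, -⟩ := hx.rightSpecial (u.length + 1)
  cases v with
  | nil => simp at hvl
  | cons a v =>
    obtain rfl := hx.rightSpecial_eq (hv.of_suffix (List.suffix_cons a v)) hu (by simpa using hvl)
    exact ⟨a, hv⟩

theorem existsUnique_isIndexSequence {ι : Type*} [AddMonoidWithOne ι] {X : Set (ι → Fin k)}
    (hx : IsARSequence x) (hk : 2 ≤ k) (hX : language X = factors x) :
    ∃! i, IsIndexSequence X i := by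
  unfold IsIndexSequence
  rw [hX]
  obtain ⟨w, hw⟩ := exists_isBispecialEnum hx hk
  choose i hi using fun n => hx.exists_cons_rightSpecial (hw.isBispecial n).1
  refine ⟨i, ⟨w, hw.1, hw.2, hi⟩, ?_⟩
  rintro i' ⟨w', h1, h2, hi'⟩
  obtain rfl := IsBispecialEnum.unique hx hw ⟨h1, h2⟩
  funext n
  exact (List.cons.inj (hx.rightSpecial_eq (hi' n) (hi n) (by simp))).1

/-! ### Linear recurrence and the index sequence -/

namespace IsBispecialEnum

variable {w : ℕ → List (Fin k)} {i : ℕ → Fin k}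

/-- The right-special word `i m :: w m` is a suffix of `w N`, and it starts with `i m :: w n`. -/
theorem cons_infix (hw : IsBispecialEnum (factors x) w) (hx : IsARSequence x)
    (hi : ∀ n, IsRightSpecial (factors x) (i n :: w n)) {n m N : ℕ} (hnm : n ≤ m) (hmN : m < N) :
    i m :: w n <:+: w N := by
  have h1 : i m :: w m <:+ w N := by
    refine hx.suffix_of_length_le (hi m) (hw.isBispecial N).1 ?_
    have : (w m).length < (w N).length := hw.1 hmN
    rw [List.length_cons]
    omega
  exact ((List.prefix_cons_inj _).2 (hw.prefix_of_le hx hnm)).isInfix.trans h1.isInfix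

/-- The suffix `a :: w m ++ q` of `w (m + g)` is right-special, so it yields an intermediate
bispecial word whose index is `a`. -/
theorem exists_index_eq_of_cons_infix (hw : IsBispecialEnum (factors x) w)
    (hx : IsARSequence x) (hi : ∀ n, IsRightSpecial (factors x) (i n :: w n)) {a : Fin k}
    {m g : ℕ} (h : a :: w m <:+: w (m + g)) : ∃ t < g, i (m + t) = a := by
  obtain ⟨p, q, hpq⟩ := h
  rw [List.append_assoc, List.cons_append] at hpq
  have hR : IsRightSpecial (factors x) (a :: (w m ++ q)) :=
    (hw.isBispecial (m + g)).1.of_suffix ⟨p, hpq⟩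
  obtain ⟨l, hl, hle, hlt, hla⟩ := hx.exists_bispecial_of_cons_rightSpecial
    (hw.isBispecial m).2 (List.prefix_append _ q) hR
  obtain ⟨r, rfl⟩ := hw.exists_eq hl
  have hmr : m ≤ r := hw.1.le_iff_le.1 hle
  have hrg : r < m + g := by
    refine hw.1.lt_iff_lt.1 (?_ : (w r).length < (w (m + g)).length)
    rw [← hpq]
    simp only [List.length_append, List.length_cons] at hlt ⊢
    omega
  exact ⟨r - m, by omega, by rw [Nat.add_sub_cancel' hmr]; exact hla _ (hi r)⟩

/-- A word that starts and ends with `w n` has period `p = (w (n + 1)).length - (w n).length`, so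
it has too few factors of length `p` to contain all those of `x`. -/
theorem length_succ_lt_mul (hw : IsBispecialEnum (factors x) w) (hx : IsARSequence x)
    (hk : 2 ≤ k) {K : ℕ} (hK : ∀ u ∈ factors x, ∀ v ∈ factors x,
      K * u.length ≤ v.length → u <:+: v) (n : ℕ) :
    (w (n + 1)).length < K * ((w (n + 1)).length - (w n).length) := by
  have hlt : (w n).length < (w (n + 1)).length := hw.1 (Nat.lt_succ_self n)
  set p := (w (n + 1)).length - (w n).length with hp
  by_contra hcon
  have hdrop : (w (n + 1)).drop p = (w (n + 1)).take ((w (n + 1)).length - p) := by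
    rw [← List.suffix_iff_eq_drop.1 (hw.suffix_of_le hx n.le_succ),
      show (w (n + 1)).length - p = (w n).length by omega,
      ← List.prefix_iff_eq_take.1 (hw.prefix_of_le hx n.le_succ)]
  have h1 := ncard_infix_le_of_drop_eq_take (by omega) hdrop
  have hsub : factorsOfLength x p ⊆ {u | u <:+: w (n + 1) ∧ u.length = p} := fun u hu =>
    ⟨hK u hu.1 _ (hw.isBispecial _).1.1 (by rw [hu.2]; omega), hu.2⟩
  have h2 := Set.ncard_le_ncard hsub ((List.finite_length_eq (Fin k) p).subset fun _ hu => hu.2)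
  rw [hx.complexity] at h2
  have h3 : 1 * p ≤ (k - 1) * p := Nat.mul_le_mul_right _ (by omega)
  omega

end IsBispecialEnum

theorem isLinearlyRecurrent_iff {ι : Type*} [AddMonoidWithOne ι] {X : Set (ι → Fin k)}
    (hx : IsARSequence x) (hk : 2 ≤ k) (hX : language X = factors x) {i : ℕ → Fin k}
    (hI : IsIndexSequence X i) :
    IsLinearlyRecurrent X ↔ ∀ a, OccursWithBoundedGaps a i := by
  unfold IsIndexSequence at hI
  unfold IsLinearlyRecurrent
  rw [hX] at hI ⊢
  obtain ⟨w, hw1, hw2, hi⟩ := hI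
  have hw : IsBispecialEnum (factors x) w := ⟨hw1, hw2⟩
  constructor
  · rintro ⟨K, -, hK⟩ a
    have hK' : ∀ u ∈ factors x, ∀ v ∈ factors x, K * u.length ≤ v.length → u <:+: v := by
      intro u hu v hv h
      have hpre := List.take_prefix (K * u.length) v
      exact (hK u hu _ (mem_factors_of_infix hv hpre.isInfix)
        (by rw [List.length_take]; omega)).trans hpre.isInfix
    -- The lengths grow by at least `1 / K` of their value, so `K * K` steps multiply them
    -- by more than `K`.
    have hgrow : ∀ m t, t * ((w m).length + 1) + K * (w m).length ≤ K * (w (m + t)).length := by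
      intro m t
      induction t with
      | zero => simp
      | succ t ih =>
        have h1 := hw.length_succ_lt_mul hx hk hK' (m + t)
        have h2 : (w (m + t)).length < (w (m + t + 1)).length := hw.1 (Nat.lt_succ_self _)
        have h3 : (w m).length ≤ (w (m + t)).length := hw.1.monotone (Nat.le_add_right _ _)
        rw [Nat.mul_sub] at h1
        rw [← add_assoc, Nat.succ_mul]
        omega
    refine ⟨K * K, fun m => hw.exists_index_eq_of_cons_infix hx hi ?_⟩
    refine hK' _ (hx.cons_mem (hw.isBispecial m).2 a) _ (hw.isBispecial _).1.1 ?_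
    have h0 : 0 < K := by
      rcases Nat.eq_zero_or_pos K with rfl | h
      · have := hw.length_succ_lt_mul hx hk hK' 0
        omega
      · exact h
    refine Nat.le_of_mul_le_mul_left ?_ h0
    rw [List.length_cons, ← mul_assoc]
    exact le_trans (Nat.le_add_right _ _) (hgrow m (K * K))
  · intro h
    choose g hg using h
    -- A common gap for all letters.
    set G := ∑ a, g a with hG
    have hgG : ∀ a, g a ≤ G := fun a =>
      Finset.single_le_sum (fun _ _ => Nat.zero_le _) (Finset.mem_univ a)
    have hall : ∀ n, ∀ u ∈ factors x, u.length ≤ (w n).length → u <:+: w (n + G) := by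
      intro n u hu hul
      obtain ⟨y, hyl, hy⟩ := exists_append_mem_factors hu ((w n).length - u.length)
      refine (List.prefix_append u y).isInfix.trans ?_
      refine hx.infix_of_forall_cons_infix (hw.isBispecial n).2 (hw.isBispecial _).1.1
        (hw.prefix_of_le hx (Nat.le_add_right _ _)) (fun a => ?_) hy
        (by rw [List.length_append]; omega)
      obtain ⟨t, ht, rfl⟩ := hg a n
      exact hw.cons_infix hx hi (Nat.le_add_right _ _) (by have := hgG (i (n + t)); omega)
    refine ⟨k * (k + 2) ^ (G + 1), by positivity, fun u hu v hv hl => ?_⟩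
    rcases Nat.eq_zero_or_pos u.length with h0 | h0
    · rw [List.eq_nil_of_length_eq_zero h0]
      exact List.nil_infix
    · have hex : ∃ n, u.length ≤ (w n).length := ⟨u.length, hw.1.le_apply⟩
      classical
      -- Let `w (n + 1)` be the first bispecial word at least as long as `u`; it is not `w 0 = []`.
      obtain ⟨n, hn⟩ : ∃ n, Nat.find hex = n + 1 := by
        refine Nat.exists_eq_succ_of_ne_zero fun h => ?_
        have := Nat.find_spec hex
        rw [h, hw.length_zero hx] at this
        omega
      have h1 : u.length ≤ (w (n + 1)).length := hn ▸ Nat.find_spec hex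
      have h2 : (w n).length < u.length := not_le.1 (Nat.find_min hex (by omega))
      refine (hall _ u hu h1).trans
        (hx.infix_of_rightSpecial (hw.isBispecial _).1 hv ?_)
      rw [hl, mul_assoc]
      refine Nat.mul_le_mul_left _ ?_
      have h3 := hw.length_add_le hx hk n (G + 1)
      rw [show n + 1 + G = n + (G + 1) by ring]
      exact (Nat.le_succ _).trans (h3.trans (Nat.mul_le_mul_left _ h2))

end AR

/-! ### Subshifts and the passage from two-sided to one-sided sequences -/

section Subshift

theorem language_subshiftOf {ι A : Type*} [AddMonoidWithOne ι] (x : ι → A) :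
    language (subshiftOf x) = factors x := by
  refine Set.Subset.antisymm ?_ fun u hu => ⟨x, fun _ => rfl, hu⟩
  rintro u ⟨y, hy, hu⟩
  have h : u ∈ factorsOfLength y u.length := ⟨hu, rfl⟩
  rw [hy] at h
  exact h.1

theorem window_comp_intCast {A : Type*} (x : ℤ → A) (j n : ℕ) :
    window (fun m : ℕ => x m) j n = window x (j : ℤ) n := by
  simp [window]

theorem factors_comp_intCast {A : Type*} {x : ℤ → A} (hx : IsUniformlyRecurrent x) :
    factors (fun m : ℕ => x m) = factors x := by
  refine Set.Subset.antisymm ?_ fun u hu => ?_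
  · rintro u ⟨j, n, rfl⟩
    exact ⟨j, n, window_comp_intCast x j n⟩
  · obtain ⟨g, hg⟩ := hx u hu
    obtain ⟨t, -, ht⟩ := hg 0
    exact ⟨t, u.length, by rw [window_comp_intCast, ← ht]; simp⟩

theorem IsARSequence.comp_intCast {k : ℕ} {x : ℤ → Fin k} (hx : IsARSequence x) :
    IsARSequence (fun m : ℕ => x m) := by
  have hf := factors_comp_intCast hx.uniformlyRecurrent
  refine ⟨fun u hu => ?_, fun n => ?_, ?_, ?_⟩
  · obtain ⟨g, hg⟩ := hx.uniformlyRecurrent u (hf ▸ hu)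
    refine ⟨g, fun j => ?_⟩
    obtain ⟨t, ht, h⟩ := hg j
    exact ⟨t, ht, by rw [window_comp_intCast, ← h]; simp⟩
  · rw [← hx.complexity n]
    unfold factorsOfLength
    rw [hf]
  · rw [hf]
    exact hx.rightSpecial
  · rw [hf]
    exact hx.leftSpecial

end Subshift

end ArnouxRauzy

theorem mainTheorem1 (k : ℕ) (hk : 2 ≤ k) :
    (∀ X : Set (ℕ → Fin k), ArnouxRauzy.IsARSubshift X →
      (∃! i : ℕ → Fin k, ArnouxRauzy.IsIndexSequence X i) ∧
      ∀ i : ℕ → Fin k, ArnouxRauzy.IsIndexSequence X i →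
        (ArnouxRauzy.IsLinearlyRecurrent X ↔
          ∀ a : Fin k, ArnouxRauzy.OccursWithBoundedGaps a i)) ∧
    (∀ X : Set (ℤ → Fin k), ArnouxRauzy.IsARSubshift X →
      (∃! i : ℕ → Fin k, ArnouxRauzy.IsIndexSequence X i) ∧
      ∀ i : ℕ → Fin k, ArnouxRauzy.IsIndexSequence X i →
        (ArnouxRauzy.IsLinearlyRecurrent X ↔
          ∀ a : Fin k, ArnouxRauzy.OccursWithBoundedGaps a i)) := by
  constructor
  · rintro X ⟨x, hx, rfl⟩
    have hX := ArnouxRauzy.language_subshiftOf x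
    exact ⟨ArnouxRauzy.existsUnique_isIndexSequence hx hk hX,
      fun i hI => ArnouxRauzy.isLinearlyRecurrent_iff hx hk hX hI⟩
  · rintro X ⟨x, hx, rfl⟩
    have hX := (ArnouxRauzy.language_subshiftOf x).trans
      (ArnouxRauzy.factors_comp_intCast hx.uniformlyRecurrent).symm
    exact ⟨ArnouxRauzy.existsUnique_isIndexSequence hx.comp_intCast hk hX,
      fun i hI => ArnouxRauzy.isLinearlyRecurrent_iff hx.comp_intCast hk hX hI⟩
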